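/- Let $\Delta_0$ be the category whose objects are those $[n]=\{0<1<\dots<n\}$ ($n\ge 0$) of the simplex category $\Delta$ and whose morphisms are the order-preserving maps that preserve the minimal element $0$. For a set $S$ let $\mathrm{sSet}^S$ be the category of $S$-indexed families of simplicial sets, with the product of the simplicial Quillen model structures (cofibrations, fibrations and weak equivalences are componentwise the monomorphisms, the Kan fibrations, and the maps whose geometric realization is a weak homotopy equivalence) and with mapping spaces the products of the componentwise mapping spaces. For a diagram $X\colon\Delta_0^{\mathrm{op}}\to\mathcal C$ in a cocomplete category, the $n$th latching object is $L_nX=\operatorname{colim}_{[n]\to[k]}X_k$, the colimit over the non-identity surjections out of $[n]$. If $\mathcal C$ is a model category, a map $X\to Y$ of diagrams is a Reedy cofibration if $X_n\amalg_{L_nX}L_nY\to Y_n$ is a cofibration for all $n\ge0$, and $X$ is Reedy cofibrant if the map from the initial diagram to $X$ is a Reedy cofibration. A monad $T$ on $\mathcal C$ is Quillen if $\mathcal C$ is a simplicial model category (bicomplete, tensored and cotensored over simplicial sets), $T$ is a simplicial monad, and the simplicial category $\mathcal C_T$ of $T$-algebras has a simplicial model structure for which the forgetful functor $U\colon\mathcal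 C_T\to\mathcal C$ is a simplicial right Quillen functor and a map $f$ is a weak equivalence if and only if $Uf$ is. For a $T$-algebra $X$ with structure map $a\colon TUX\to UX$, let $T^\bullet UX\colon\Delta_0^{\mathrm{op}}\to\mathcal C$ be the diagram $[n]\mapsto T^nUX$ with the faces (other than $d_0$) and degeneracies of the bar construction: $d_i=T^{i-1}\mu T^{n-i-1}$ for $0<i<n$, $d_n=T^{n-1}a$, and $s_i=T^i\eta T^{n-i}$ for $0\le i\le n$. The algebra $X$ is resolvable if it is weakly equivalent in $\mathcal C_T$ (through a zigzag of weak equivalences) to a $T$-algebra $\widetilde X$ such that $T^\bullet U\widetilde X$ is Reedy cofibrant. Then the following hold. 1. With the surjections as degree-lowering maps, the injections as degree-raising maps, and $[n]$ of degree $n$, $\Delta_0$ is an Eilenberg–Zilber Reedy category: it is a Reedy category; every surjection $\sigma$ of $\Delta_0$ has a nonempty set $\Gamma(\sigma)=\{\tau\in\Delta_0:\sigma\tau=\mathrm{id}\}$ of sections; and any two distinct parallel surjections $\sigma_1\ne\sigma_2$ satisfy $\Gamma(\sigma_1)\ne\Gamma(\sigma_2)$. 2. For every set $S$, every diagram $X\colon\Delta_0^{\mathrm{op}}\to\mathrm{sSet}^S$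 is Reedy cofibrant. 3. For every set $S$ and every Quillen monad $T$ on $\mathrm{sSet}^S$, every $T$-algebra is resolvable. -/

import Mathlib

open CategoryTheory Limits MonoidalCategory HomotopicalAlgebra Opposite

universe u v w

/-! ### The category `Δ₀` -/

/-- The morphisms of `Δ` which preserve the minimal element. -/
def minPreserving : MorphismProperty SimplexCategory :=
  fun _ _ f => f.toOrderHom 0 = 0

instance : minPreserving.IsMultiplicative where
  id_mem _ := rfl
  comp_mem f g hf hg := by
    change g.toOrderHom (f.toOrderHom 0) = 0
    rw [show f.toOrderHom 0 = 0 from hf]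
    exact hg

/-- The category `Δ₀`: the objects of `Δ`, with the order maps preserving the minimal element. -/
abbrev DeltaZero : Type := WideSubcategory minPreserving

namespace DeltaZero

/-- The surjections in `Δ₀`. -/
def surjections : MorphismProperty DeltaZero :=
  fun _ _ f => Function.Surjective f.hom.toOrderHom

/-- The injections in `Δ₀`. -/
def injections : MorphismProperty DeltaZero :=
  fun _ _ f => Function.Injective f.hom.toOrderHom

instance : surjections.IsMultiplicative where
  id_mem _ := Function.surjective_id
  comp_mem f g hf hg := by
    have := Function.Surjective.comp (g := g.hom.toOrderHom) (f := f.hom.toOrderHom) hg hf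
    exact this

instance : injections.IsMultiplicative where
  id_mem _ := Function.injective_id
  comp_mem f g hf hg := by
    have := Function.Injective.comp (g := g.hom.toOrderHom) (f := f.hom.toOrderHom) hg hf
    exact this

end DeltaZero

/-! ### Eilenberg–Zilber Reedy categories -/

/-- The set `Γ(σ)` of sections of a morphism `σ`. -/
def sectionsOf {R : Type u} [Category.{v} R] {X Y : R} (σ : X ⟶ Y) : Set (Y ⟶ X) :=
  {τ | τ ≫ σ = 𝟙 Y}

/-- A Reedy category, with degree-lowering maps `Wm` and degree-raising maps `Wp`, is an
Eilenberg–Zilber Reedy category if every degree-lowering map has a section, and distinct parallel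
degree-lowering maps have distinct sets of sections. -/
structure IsEilenbergZilber {R : Type u} [Category.{v} R] {Wm Wp : MorphismProperty R}
    [Wm.IsMultiplicative] [Wp.IsMultiplicative] (_r : ReedyStructure Wm Wp ℕ) : Prop where
  ez1 : ∀ ⦃X Y : R⦄ (σ : X ⟶ Y), Wm σ → (sectionsOf σ).Nonempty
  ez2 : ∀ ⦃X Y : R⦄ (σ₁ σ₂ : X ⟶ Y), Wm σ₁ → Wm σ₂ → σ₁ ≠ σ₂ → sectionsOf σ₁ ≠ sectionsOf σ₂

/-! ### Latching objects and Reedy cofibrations of `Δ₀ᵒᵖ`-diagrams -/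

namespace DeltaZero

/-- The objects under `n` which are given by a non-identity surjection out of `n`. -/
def nonIdentitySurjections (n : DeltaZero) : ObjectProperty (Under n) :=
  fun σ => surjections σ.hom ∧ ¬ MorphismProperty.identities DeltaZero σ.hom

/-- The category indexing the `n`-th latching object: the non-identity surjections out of `n`,
with the morphisms under `n` between them. -/
abbrev LatchingIndex (n : DeltaZero) : Type := (nonIdentitySurjections n).FullSubcategory

section

variable {C : Type v} [Category.{w} C]

/-- The diagram `([n] → [k]) ↦ X_k` on the non-identity surjections out of `[n]`. -/
abbrev latchingDiagram (X : DeltaZeroᵒᵖ ⥤ C) (n : DeltaZero) : (LatchingIndex n)ᵒᵖ ⥤ C :=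
  ((nonIdentitySurjections n).ι ⋙ Under.forget n).op ⋙ X

/-- The cocone on the latching diagram with point `X_n`, given by the degeneracies. -/
def latchingCocone (X : DeltaZeroᵒᵖ ⥤ C) (n : DeltaZero) : Cocone (latchingDiagram X n) where
  pt := X.obj (op n)
  ι :=
    { app := fun σ => X.map σ.unop.obj.hom.op
      naturality := fun σ τ f => by
        dsimp
        rw [Category.comp_id, ← X.map_comp, ← op_comp]
        exact congrArg (fun t => X.map (Quiver.Hom.op t)) (Under.w f.unop.hom) }

variable [HasColimitsOfSize.{0, 0} C]

/-- The latching object `L_n X`, the colimit of the `X_k` over the non-identity surjections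
`[n] → [k]`. -/
noncomputable abbrev latchingObj (X : DeltaZeroᵒᵖ ⥤ C) (n : DeltaZero) : C :=
  colimit (latchingDiagram X n)

/-- The latching map `L_n X ⟶ X_n`. -/
noncomputable def latchingMap (X : DeltaZeroᵒᵖ ⥤ C) (n : DeltaZero) :
    latchingObj X n ⟶ X.obj (op n) :=
  colimit.desc (latchingDiagram X n) (latchingCocone X n)

/-- The map `L_n X ⟶ L_n Y` induced by a map of diagrams. -/
noncomputable def latchingObjMap {X Y : DeltaZeroᵒᵖ ⥤ C} (f : X ⟶ Y) (n : DeltaZero) :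
    latchingObj X n ⟶ latchingObj Y n :=
  colimMap (Functor.whiskerLeft ((nonIdentitySurjections n).ι ⋙ Under.forget n).op f)

lemma latching_comm {X Y : DeltaZeroᵒᵖ ⥤ C} (f : X ⟶ Y) (n : DeltaZero) :
    latchingMap X n ≫ f.app (op n) = latchingObjMap f n ≫ latchingMap Y n := by
  apply colimit.hom_ext
  intro σ
  have h₁ : colimit.ι (latchingDiagram X n) σ ≫ latchingMap X n = X.map σ.unop.obj.hom.op :=
    colimit.ι_desc _ _
  have h₂ : colimit.ι (latchingDiagram Y n) σ ≫ latchingMap Y n = Y.map σ.unop.obj.hom.op :=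
    colimit.ι_desc _ _
  have h₃ : colimit.ι (latchingDiagram X n) σ ≫ latchingObjMap f n =
      f.app _ ≫ colimit.ι (latchingDiagram Y n) σ := ι_colimMap _ _
  rw [← Category.assoc, h₁, ← Category.assoc, h₃, Category.assoc, h₂]
  exact f.naturality _

/-- The relative latching map `X_n ⨿_{L_n X} L_n Y ⟶ Y_n`. -/
noncomputable def relativeLatchingMap {X Y : DeltaZeroᵒᵖ ⥤ C} (f : X ⟶ Y) (n : DeltaZero) :
    pushout (latchingMap X n) (latchingObjMap f n) ⟶ Y.obj (op n) :=
  pushout.desc (f.app (op n)) (latchingMap Y n) (latching_comm f n)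

variable [CategoryWithCofibrations C]

/-- Reedy cofibrations in `C^{Δ₀ᵒᵖ}`. -/
def IsReedyCofibration {X Y : DeltaZeroᵒᵖ ⥤ C} (f : X ⟶ Y) : Prop :=
  ∀ n : DeltaZero, Cofibration (relativeLatchingMap f n)

/-- A diagram is Reedy cofibrant if the map from the initial diagram is a Reedy cofibration. -/
def IsReedyCofibrant (X : DeltaZeroᵒᵖ ⥤ C) : Prop :=
  IsReedyCofibration (initial.to X)

end

end DeltaZero

/-! ### The Quillen structure on simplicial sets -/

/-- The map on homotopy groups (or sets) induced by a continuous map. -/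
def homotopyGroupMap (n : ℕ) {X : Type u} {Y : Type v} [TopologicalSpace X] [TopologicalSpace Y]
    (f : C(X, Y)) (x : X) : HomotopyGroup (Fin n) X x → HomotopyGroup (Fin n) Y (f x) :=
  Quotient.map (fun γ => ⟨f.comp γ.1, fun y hy => congrArg f (γ.2 y hy)⟩)
    (fun _ _ h => ContinuousMap.HomotopicRel.comp_continuousMap h f)

/-- The map on path components induced by a continuous map. -/
def zerothHomotopyMap {X : Type u} {Y : Type v} [TopologicalSpace X] [TopologicalSpace Y]
    (f : C(X, Y)) : ZerothHomotopy X → ZerothHomotopy Y :=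
  Quotient.map f (fun _ _ h => h.map f.continuous)

/-- Weak homotopy equivalences of topological spaces. -/
structure IsWeakHomotopyEquiv {X : Type u} {Y : Type v} [TopologicalSpace X] [TopologicalSpace Y]
    (f : C(X, Y)) : Prop where
  bijective_zeroth : Function.Bijective (zerothHomotopyMap f)
  bijective_pi : ∀ (n : ℕ) (x : X), Function.Bijective (homotopyGroupMap (n + 1) f x)

/-- A map of simplicial sets is a weak equivalence if its geometric realization is a weak
homotopy equivalence. (The cofibrations and fibrations of simplicial sets are those of Mathlib: the
monomorphisms and the Kan fibrations.) -/
instance : CategoryWithWeakEquivalences SSet.{u} where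
  weakEquivalences := fun _ _ f => IsWeakHomotopyEquiv (SSet.toTop.map f).hom

open scoped SSet.modelCategoryQuillen

/-! ### The simplicial category `sSet^S`, with the product classes of maps -/

/-- The category `sSet^S` of families of simplicial sets indexed by `S`. -/
abbrev SSetPow (S : Type u) : Type (u + 1) := S → SSet.{u}

namespace SSetPow

variable (S : Type u)

instance : CategoryWithCofibrations (SSetPow S) where
  cofibrations := .pi fun _ => cofibrations SSet.{u}

instance : CategoryWithFibrations (SSetPow S) where
  fibrations := .pi fun _ => fibrations SSet.{u}

instance : CategoryWithWeakEquivalences (SSetPow S) where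
  weakEquivalences := .pi fun _ => weakEquivalences SSet.{u}

instance : HasColimits (SSetPow S) where
  has_colimits_of_shape _ _ := ⟨fun _ => pi.hasColimit_of_hasColimit_comp_eval⟩

section

open SimplicialCategory

variable {S}

/-- The mapping space from `X` to `Y` in `sSet^S`: the product over `s : S` of the mapping spaces
from `X s` to `Y s`. -/
noncomputable def mapSpace (X Y : SSetPow S) : SSet.{u} := ∏ᶜ fun s => sHom (X s) (Y s)

/-- The projections of a mapping space of `sSet^S`. -/
noncomputable def mapSpaceπ (X Y : SSetPow S) (s : S) : mapSpace X Y ⟶ sHom (X s) (Y s) :=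
  Pi.π _ s

/-- The map into a mapping space of `sSet^S` with given components. -/
noncomputable def mapSpaceLift {K : SSet.{u}} {X Y : SSetPow S}
    (f : ∀ s, K ⟶ sHom (X s) (Y s)) : K ⟶ mapSpace X Y :=
  Pi.lift f

lemma mapSpaceLift_π {K : SSet.{u}} {X Y : SSetPow S} (f : ∀ s, K ⟶ sHom (X s) (Y s)) (s : S) :
    mapSpaceLift f ≫ mapSpaceπ X Y s = f s :=
  Pi.lift_π _ _

lemma mapSpace_hom_ext {K : SSet.{u}} {X Y : SSetPow S} {f g : K ⟶ mapSpace X Y}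
    (h : ∀ s, f ≫ mapSpaceπ X Y s = g ≫ mapSpaceπ X Y s) : f = g :=
  Pi.hom_ext _ _ h

/-- The composition of mapping spaces of `sSet^S`. -/
noncomputable def mapSpaceComp (X Y Z : SSetPow S) : mapSpace X Y ⊗ mapSpace Y Z ⟶ mapSpace X Z :=
  mapSpaceLift fun s => (mapSpaceπ X Y s ⊗ₘ mapSpaceπ Y Z s) ≫ sHomComp (X s) (Y s) (Z s)

lemma mapSpaceComp_π (X Y Z : SSetPow S) (s : S) :
    mapSpaceComp X Y Z ≫ mapSpaceπ X Z s =
      (mapSpaceπ X Y s ⊗ₘ mapSpaceπ Y Z s) ≫ sHomComp (X s) (Y s) (Z s) :=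
  mapSpaceLift_π _ _

lemma mapSpaceComp_tensor_π {X Y Z : SSetPow S} (a : 𝟙_ SSet.{u} ⟶ mapSpace X Y)
    (b : 𝟙_ SSet.{u} ⟶ mapSpace Y Z) (s : S) :
    ((λ_ (𝟙_ SSet.{u})).inv ≫ (a ⊗ₘ b) ≫ mapSpaceComp X Y Z) ≫ mapSpaceπ X Z s =
      (λ_ (𝟙_ SSet.{u})).inv ≫ ((a ≫ mapSpaceπ X Y s) ⊗ₘ (b ≫ mapSpaceπ Y Z s)) ≫
        sHomComp (X s) (Y s) (Z s) := by
  rw [Category.assoc, Category.assoc, mapSpaceComp_π, tensorHom_comp_tensorHom_assoc]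

noncomputable instance : EnrichedCategory SSet.{u} (SSetPow S) where
  Hom := mapSpace
  id X := mapSpaceLift fun s => eId SSet.{u} (X s)
  comp := mapSpaceComp
  id_comp X Y := by
    apply mapSpace_hom_ext
    intro s
    rw [Category.assoc, Category.assoc, mapSpaceComp_π, whiskerRight_comp_tensorHom_assoc,
      mapSpaceLift_π, tensorHom_def', Category.assoc, ← leftUnitor_inv_naturality_assoc,
      e_id_comp, Category.comp_id, Category.id_comp]
  comp_id X Y := by
    apply mapSpace_hom_ext
    intro s
    rw [Category.assoc, Category.assoc, mapSpaceComp_π, whiskerLeft_comp_tensorHom_assoc,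
      mapSpaceLift_π, MonoidalCategory.tensorHom_def, Category.assoc, ← rightUnitor_inv_naturality_assoc,
      e_comp_id, Category.comp_id, Category.id_comp]
  assoc W X Y Z := by
    apply mapSpace_hom_ext
    intro s
    have h := e_assoc SSet.{u} (W s) (X s) (Y s) (Z s)
    simp only [Category.assoc, mapSpaceComp_π, whiskerRight_comp_tensorHom_assoc,
      whiskerLeft_comp_tensorHom_assoc]
    rw [← tensorHom_comp_whiskerRight, ← tensorHom_comp_whiskerLeft, Category.assoc,
      Category.assoc, ← associator_inv_naturality_assoc, h]

/-- The simplicial enrichment of `sSet^S`, with mapping spaces the products of those of `sSet`. -/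
noncomputable instance : SimplicialCategory (SSetPow S) where
  homEquiv {X Y} :=
    { toFun := fun f => mapSpaceLift fun s => eHomEquiv SSet.{u} (f s)
      invFun := fun g s => (eHomEquiv SSet.{u}).symm (g ≫ mapSpaceπ X Y s)
      left_inv := fun f => by
        funext s
        simp [mapSpaceLift_π]
      right_inv := fun g => by
        apply mapSpace_hom_ext
        intro s
        simp [mapSpaceLift_π] }
  homEquiv_id X := by
    apply mapSpace_hom_ext
    intro s
    exact (mapSpaceLift_π _ _).trans
      ((eHomEquiv_id SSet.{u} (X s)).trans
        (mapSpaceLift_π (X := X) (Y := X) (fun s => eId SSet.{u} (X s)) s).symm)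
  homEquiv_comp {X Y Z} f g := by
    apply mapSpace_hom_ext
    intro s
    have h := eHomEquiv_comp SSet.{u} (f s) (g s)
    refine (mapSpaceLift_π _ _).trans (h.trans ?_)
    refine Eq.trans ?_ (mapSpaceComp_tensor_π _ _ s).symm
    simp only [Equiv.coe_fn_mk, mapSpaceLift_π]

end

end SSetPow

/-! ### Simplicial model categories -/

section

variable (C : Type v) [Category.{w} C] [CategoryWithCofibrations C] [CategoryWithFibrations C]
  [CategoryWithWeakEquivalences C]

/-- The axioms of a (bicomplete) model category, for given classes of cofibrations, fibrations and
weak equivalences. -/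
structure IsModelCategory : Prop where
  hasLimits : HasLimits C
  hasColimits : HasColimits C
  cofibrations_mul : (cofibrations C).IsMultiplicative
  fibrations_mul : (fibrations C).IsMultiplicative
  weakEquivalences_mul : (weakEquivalences C).IsMultiplicative
  twoOutOfThree : (weakEquivalences C).HasTwoOutOfThreeProperty
  weakEquivalences_retract : (weakEquivalences C).IsStableUnderRetracts
  fibrations_retract : (fibrations C).IsStableUnderRetracts
  cofibrations_retract : (cofibrations C).IsStableUnderRetracts
  lift_trivialFibration : ∀ ⦃A B X Y : C⦄ (i : A ⟶ B) (p : X ⟶ Y),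
    cofibrations C i → trivialFibrations C p → HasLiftingProperty i p
  lift_trivialCofibration : ∀ ⦃A B X Y : C⦄ (i : A ⟶ B) (p : X ⟶ Y),
    trivialCofibrations C i → fibrations C p → HasLiftingProperty i p
  factorization_trivialCofibration :
    MorphismProperty.HasFactorization (trivialCofibrations C) (fibrations C)
  factorization_trivialFibration :
    MorphismProperty.HasFactorization (cofibrations C) (trivialFibrations C)

end

section

open SimplicialCategory

variable {C : Type v} [Category.{w} C] [SimplicialCategory C]

/-- `u : K ⟶ C(X, P)` exhibits `P` as the simplicial tensor `X ⊗ K`: for every `Y`, composition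
with `u` is an isomorphism from `C(P, Y)` to the internal hom from `K` to `C(X, Y)`. -/
def IsSimplicialTensor {K : SSet.{w}} {X P : C} (u : K ⟶ sHom X P) : Prop :=
  ∀ (Y : C) (L : SSet.{w}),
    Function.Bijective fun l : L ⟶ sHom P Y => (u ⊗ₘ l) ≫ sHomComp X P Y

/-- `e : K ⟶ C(P, Y)` exhibits `P` as the simplicial cotensor `Y ^ K`: for every `X`, composition
with `e` is an isomorphism from `C(X, P)` to the internal hom from `K` to `C(X, Y)`. -/
def IsSimplicialCotensor {K : SSet.{w}} {Y P : C} (e : K ⟶ sHom P Y) : Prop :=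
  ∀ (X : C) (L : SSet.{w}),
    Function.Bijective fun l : L ⟶ sHom X P => (l ⊗ₘ e) ≫ sHomComp X P Y

/-- For cotensors `P = A ^ L` and `Q = B ^ K`, the property of a map `P ⟶ Q` of being the one
induced by `i : K ⟶ L` and `p : A ⟶ B`. -/
def IsCotensorMap {K L : SSet.{w}} {A B P Q : C} (i : K ⟶ L) (p : A ⟶ B)
    (eP : L ⟶ sHom P A) (eQ : K ⟶ sHom Q B) (q : P ⟶ Q) : Prop :=
  eQ ≫ eHomWhiskerRight SSet.{w} q B = i ≫ eP ≫ eHomWhiskerLeft SSet.{w} P p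

variable (C) in
/-- A simplicial model category: a bicomplete model category enriched, tensored and cotensored
over simplicial sets, such that for every cofibration `i : K ⟶ L` of simplicial sets and every
fibration `p : A ⟶ B`, the induced map `A ^ L ⟶ A ^ K ×_{B ^ K} B ^ L` is a fibration, which is a
weak equivalence if `i` or `p` is. -/
structure IsSimplicialModelCategory [CategoryWithCofibrations C] [CategoryWithFibrations C]
    [CategoryWithWeakEquivalences C] : Prop where
  isModelCategory : IsModelCategory C
  exists_tensor : ∀ (K : SSet.{w}) (X : C), ∃ (P : C) (t : K ⟶ sHom X P), IsSimplicialTensor t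
  exists_cotensor : ∀ (K : SSet.{w}) (Y : C), ∃ (P : C) (e : K ⟶ sHom P Y), IsSimplicialCotensor e
  corner : ∀ ⦃K L : SSet.{w}⦄ (i : K ⟶ L) ⦃A B : C⦄ (p : A ⟶ B), Cofibration i → Fibration p →
    ∀ ⦃AL AK BL BK : C⦄ (eAL : L ⟶ sHom AL A) (eAK : K ⟶ sHom AK A) (eBL : L ⟶ sHom BL B)
      (eBK : K ⟶ sHom BK B), IsSimplicialCotensor eAL → IsSimplicialCotensor eAK →
      IsSimplicialCotensor eBL → IsSimplicialCotensor eBK →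
    ∀ (iA : AL ⟶ AK) (iB : BL ⟶ BK) (pL : AL ⟶ BL) (pK : AK ⟶ BK),
      IsCotensorMap i (𝟙 A) eAL eAK iA → IsCotensorMap i (𝟙 B) eBL eBK iB →
      IsCotensorMap (𝟙 L) p eAL eBL pL → IsCotensorMap (𝟙 K) p eAK eBK pK →
    ∀ ⦃D : C⦄ (fst : D ⟶ AK) (snd : D ⟶ BL), IsPullback fst snd pK iB →
    ∀ c : AL ⟶ D, c ≫ fst = iA → c ≫ snd = pL →
      Fibration c ∧ ((WeakEquivalence i ∨ WeakEquivalence p) → WeakEquivalence c)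

/-! ### Simplicial monads and their algebras -/

/-- The structure of a simplicial monad on a monad `T`: the action of `T` on mapping spaces, such
that `T` is a simplicial functor and its unit and multiplication are simplicially natural. -/
structure SimplicialMonadStructure (T : Monad C) where
  map (X Y : C) : sHom X Y ⟶ sHom (T.obj X) (T.obj Y)
  map_id (X : C) : eId SSet.{w} X ≫ map X X = eId SSet.{w} (T.obj X)
  map_comp (X Y Z : C) : sHomComp X Y Z ≫ map X Z =
    (map X Y ⊗ₘ map Y Z) ≫ sHomComp (T.obj X) (T.obj Y) (T.obj Z)
  map_homEquiv {X Y : C} (f : X ⟶ Y) :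
    eHomEquiv SSet.{w} f ≫ map X Y = eHomEquiv SSet.{w} (T.map f)
  unit_natural (X Y : C) : eHomWhiskerLeft SSet.{w} X (T.η.app Y) =
    map X Y ≫ eHomWhiskerRight SSet.{w} (T.η.app X) (T.obj Y)
  mul_natural (X Y : C) :
    map X Y ≫ map (T.obj X) (T.obj Y) ≫
        eHomWhiskerLeft SSet.{w} (T.obj (T.obj X)) (T.μ.app Y) =
      map X Y ≫ eHomWhiskerRight SSet.{w} (T.μ.app X) (T.obj Y)

lemma eHomEquiv_whiskerLeft {X Y Z : C} (f : X ⟶ Y) (g : Y ⟶ Z) :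
    eHomEquiv SSet.{w} f ≫ eHomWhiskerLeft SSet.{w} X g = eHomEquiv SSet.{w} (f ≫ g) := by
  rw [eHomEquiv_comp, eHomWhiskerLeft, unitors_inv_equal, rightUnitor_inv_comp_tensorHom_assoc]

lemma eHomEquiv_whiskerRight {X Y Z : C} (f : X ⟶ Y) (g : Y ⟶ Z) :
    eHomEquiv SSet.{w} g ≫ eHomWhiskerRight SSet.{w} f Z = eHomEquiv SSet.{w} (f ≫ g) := by
  rw [eHomEquiv_comp, eHomWhiskerRight, leftUnitor_inv_comp_tensorHom_assoc]

lemma eHomWhisker_middle (X : C) {Y Y' : C} (g : Y ⟶ Y') (Z : C) :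
    eHomWhiskerLeft SSet.{w} X g ▷ sHom Y' Z ≫ sHomComp X Y' Z =
      sHom X Y ◁ eHomWhiskerRight SSet.{w} g Z ≫ sHomComp X Y Z := by
  simp only [eHomWhiskerLeft, eHomWhiskerRight, comp_whiskerRight, whisker_assoc,
    MonoidalCategory.whiskerLeft_comp, Category.assoc]
  rw [← e_assoc']
  simp

namespace SimplicialMonadStructure

variable {T : Monad C} (h : SimplicialMonadStructure T)

/-- The mapping space between two `T`-algebras: the equalizer of the two maps
`C(UX, UY) ⇉ C(TUX, UY)` expressing the compatibility with the structure maps. -/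
noncomputable def algHom (X Y : T.Algebra) : SSet.{w} :=
  equalizer (h.map X.A Y.A ≫ eHomWhiskerLeft SSet.{w} (T.obj X.A) Y.a)
    (eHomWhiskerRight SSet.{w} X.a Y.A)

/-- The inclusion of the mapping space of two algebras in that of the underlying objects; this is
the simplicial structure of the forgetful functor. -/
noncomputable def algHomι (X Y : T.Algebra) : h.algHom X Y ⟶ sHom X.A Y.A :=
  equalizer.ι _ _

lemma algHom_condition (X Y : T.Algebra) :
    h.algHomι X Y ≫ h.map X.A Y.A ≫ eHomWhiskerLeft SSet.{w} (T.obj X.A) Y.a =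
      h.algHomι X Y ≫ eHomWhiskerRight SSet.{w} X.a Y.A :=
  equalizer.condition _ _

/-- The map into a mapping space of algebras induced by a compatible map. -/
noncomputable def algHomLift {X Y : T.Algebra} {K : SSet.{w}} (f : K ⟶ sHom X.A Y.A)
    (hf : f ≫ h.map X.A Y.A ≫ eHomWhiskerLeft SSet.{w} (T.obj X.A) Y.a =
      f ≫ eHomWhiskerRight SSet.{w} X.a Y.A) : K ⟶ h.algHom X Y :=
  equalizer.lift f hf

lemma algHomLift_ι {X Y : T.Algebra} {K : SSet.{w}} (f : K ⟶ sHom X.A Y.A)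
    (hf : f ≫ h.map X.A Y.A ≫ eHomWhiskerLeft SSet.{w} (T.obj X.A) Y.a =
      f ≫ eHomWhiskerRight SSet.{w} X.a Y.A) : h.algHomLift f hf ≫ h.algHomι X Y = f :=
  equalizer.lift_ι _ _

lemma algHom_ext {X Y : T.Algebra} {K : SSet.{w}} {f g : K ⟶ h.algHom X Y}
    (e : f ≫ h.algHomι X Y = g ≫ h.algHomι X Y) : f = g :=
  equalizer.hom_ext e

lemma homEquiv_condition {X Y : T.Algebra} (f : X.A ⟶ Y.A) :
    eHomEquiv SSet.{w} f ≫ h.map X.A Y.A ≫ eHomWhiskerLeft SSet.{w} (T.obj X.A) Y.a =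
      eHomEquiv SSet.{w} f ≫ eHomWhiskerRight SSet.{w} X.a Y.A ↔
    T.map f ≫ Y.a = X.a ≫ f := by
  rw [← Category.assoc, h.map_homEquiv, eHomEquiv_whiskerLeft, eHomEquiv_whiskerRight,
    (eHomEquiv SSet.{w}).apply_eq_iff_eq]

/-- The identity of an algebra, in its mapping space. -/
noncomputable def algId (X : T.Algebra) : 𝟙_ SSet.{w} ⟶ h.algHom X X :=
  h.algHomLift (eId SSet.{w} X.A) (by
    rw [← eHomEquiv_id, homEquiv_condition]
    simp)

lemma algComp_condition (X Y Z : T.Algebra) :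
    ((h.algHomι X Y ⊗ₘ h.algHomι Y Z) ≫ sHomComp X.A Y.A Z.A) ≫ h.map X.A Z.A ≫
        eHomWhiskerLeft SSet.{w} (T.obj X.A) Z.a =
      ((h.algHomι X Y ⊗ₘ h.algHomι Y Z) ≫ sHomComp X.A Y.A Z.A) ≫
        eHomWhiskerRight SSet.{w} X.a Z.A := by
  have h₁ := h.map_comp X.A Y.A Z.A
  have h₂ := eComp_eHomWhiskerLeft SSet.{w} (T.obj X.A) (T.obj Y.A) Z.a
  have h₃ := eComp_eHomWhiskerRight SSet.{w} X.a Y.A Z.A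
  have h₄ := eHomWhisker_middle (T.obj X.A) Y.a Z.A
  calc
    _ = (h.algHomι X Y ⊗ₘ h.algHomι Y Z) ≫ (sHomComp X.A Y.A Z.A ≫ h.map X.A Z.A) ≫
        eHomWhiskerLeft SSet.{w} (T.obj X.A) Z.a := by simp only [Category.assoc]
    _ = (h.algHomι X Y ⊗ₘ h.algHomι Y Z) ≫ (h.map X.A Y.A ⊗ₘ h.map Y.A Z.A) ≫
        sHomComp _ _ _ ≫ eHomWhiskerLeft SSet.{w} (T.obj X.A) Z.a := by
      rw [h₁, Category.assoc]
    _ = ((h.algHomι X Y ≫ h.map X.A Y.A) ⊗ₘ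
          (h.algHomι Y Z ≫ h.map Y.A Z.A ≫ eHomWhiskerLeft SSet.{w} (T.obj Y.A) Z.a)) ≫
        sHomComp _ _ _ := by
      rw [h₂, tensorHom_comp_tensorHom_assoc, tensorHom_comp_whiskerLeft_assoc, Category.assoc]
    _ = ((h.algHomι X Y ≫ h.map X.A Y.A) ⊗ₘ h.algHomι Y Z) ≫
        (_ ◁ eHomWhiskerRight SSet.{w} Y.a Z.A) ≫ sHomComp _ _ _ := by
      rw [algHom_condition, tensorHom_comp_whiskerLeft_assoc]
    _ = ((h.algHomι X Y ≫ h.map X.A Y.A ≫ eHomWhiskerLeft SSet.{w} (T.obj X.A) Y.a) ⊗ₘ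
          h.algHomι Y Z) ≫ sHomComp _ _ _ := by
      rw [← h₄, tensorHom_comp_whiskerRight_assoc, Category.assoc]
    _ = _ := by
      rw [algHom_condition, Category.assoc, h₃, tensorHom_comp_whiskerRight_assoc]

/-- The composition of mapping spaces of algebras. -/
noncomputable def algComp (X Y Z : T.Algebra) :
    h.algHom X Y ⊗ h.algHom Y Z ⟶ h.algHom X Z :=
  h.algHomLift ((h.algHomι X Y ⊗ₘ h.algHomι Y Z) ≫ sHomComp X.A Y.A Z.A)
    (h.algComp_condition X Y Z)

lemma algComp_ι (X Y Z : T.Algebra) : h.algComp X Y Z ≫ h.algHomι X Z =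
    (h.algHomι X Y ⊗ₘ h.algHomι Y Z) ≫ sHomComp X.A Y.A Z.A :=
  h.algHomLift_ι _ _

lemma algComp_tensor_ι {X Y Z : T.Algebra} (a : 𝟙_ SSet.{w} ⟶ h.algHom X Y)
    (b : 𝟙_ SSet.{w} ⟶ h.algHom Y Z) :
    ((λ_ (𝟙_ SSet.{w})).inv ≫ (a ⊗ₘ b) ≫ h.algComp X Y Z) ≫ h.algHomι X Z =
      (λ_ (𝟙_ SSet.{w})).inv ≫ ((a ≫ h.algHomι X Y) ⊗ₘ (b ≫ h.algHomι Y Z)) ≫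
        sHomComp X.A Y.A Z.A := by
  rw [Category.assoc, Category.assoc, algComp_ι, tensorHom_comp_tensorHom_assoc]

lemma algId_ι (X : T.Algebra) : h.algId X ≫ h.algHomι X X = eId SSet.{w} X.A :=
  h.algHomLift_ι _ _

/-- The enrichment of the category of `T`-algebras over simplicial sets. -/
noncomputable abbrev algebraEnrichedCategory : EnrichedCategory SSet.{w} T.Algebra where
  Hom := h.algHom
  id := h.algId
  comp := h.algComp
  id_comp X Y := by
    apply h.algHom_ext
    rw [Category.assoc, Category.assoc, algComp_ι, whiskerRight_comp_tensorHom_assoc,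
      algId_ι, tensorHom_def', Category.assoc, ← leftUnitor_inv_naturality_assoc,
      e_id_comp, Category.comp_id, Category.id_comp]
  comp_id X Y := by
    apply h.algHom_ext
    rw [Category.assoc, Category.assoc, algComp_ι, whiskerLeft_comp_tensorHom_assoc,
      algId_ι, MonoidalCategory.tensorHom_def, Category.assoc, ← rightUnitor_inv_naturality_assoc,
      e_comp_id, Category.comp_id, Category.id_comp]
  assoc W X Y Z := by
    apply h.algHom_ext
    have e := e_assoc SSet.{w} W.A X.A Y.A Z.A
    simp only [Category.assoc, algComp_ι, whiskerRight_comp_tensorHom_assoc,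
      whiskerLeft_comp_tensorHom_assoc]
    rw [← tensorHom_comp_whiskerRight, ← tensorHom_comp_whiskerLeft, Category.assoc,
      Category.assoc, ← associator_inv_naturality_assoc, e]

/-- The simplicial category of algebras over a simplicial monad. -/
noncomputable abbrev algebraSimplicialCategory : SimplicialCategory T.Algebra where
  toEnrichedCategory := h.algebraEnrichedCategory
  homEquiv {X Y} :=
    { toFun := fun f => h.algHomLift (eHomEquiv SSet.{w} f.f) ((h.homEquiv_condition f.f).2 f.h)
      invFun := fun g =>
        { f := (eHomEquiv SSet.{w}).symm (g ≫ h.algHomι X Y)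
          h := by
            rw [← h.homEquiv_condition, Equiv.apply_symm_apply, Category.assoc, Category.assoc,
              algHom_condition] }
      left_inv := fun f => by
        ext
        simp [algHomLift_ι]
      right_inv := fun g => by
        apply h.algHom_ext
        simp [algHomLift_ι] }
  homEquiv_id X := by
    apply h.algHom_ext
    exact (h.algHomLift_ι _ _).trans ((eHomEquiv_id SSet.{w} X.A).trans (h.algId_ι X).symm)
  homEquiv_comp {X Y Z} f g := by
    apply h.algHom_ext
    refine (h.algHomLift_ι _ _).trans ((eHomEquiv_comp SSet.{w} f.f g.f).trans ?_)
    refine Eq.trans ?_ (h.algComp_tensor_ι _ _).symm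
    simp only [Equiv.coe_fn_mk, algHomLift_ι]

end SimplicialMonadStructure

end

/-! ### The `Δ₀ᵒᵖ`-diagram of an algebra -/

section

variable {C : Type v} [Category.{w} C] {T : Monad C}

/-- The objects `T^n A`. -/
def monadPow (T : Monad C) (A : C) : ℕ → C
  | 0 => A
  | n + 1 => T.obj (monadPow T A n)

section

variable {A : C}

/-- The functor `T` on maps between the objects `T^n A`. -/
def mapPow {n m : ℕ} (f : monadPow T A n ⟶ monadPow T A m) :
    monadPow T A (n + 1) ⟶ monadPow T A (m + 1) :=
  T.map f

/-- The unit `η : T^n A ⟶ T T^n A`. -/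
def unitPow (T : Monad C) (A : C) (n : ℕ) : monadPow T A n ⟶ monadPow T A (n + 1) :=
  T.η.app (monadPow T A n)

/-- The multiplication `μ : T T T^n A ⟶ T T^n A`. -/
def mulPow (T : Monad C) (A : C) (n : ℕ) : monadPow T A (n + 2) ⟶ monadPow T A (n + 1) :=
  T.μ.app (monadPow T A n)

/-- The structure map `TX ⟶ X` of an algebra. -/
def actPow (X : T.Algebra) : monadPow T X.A 1 ⟶ monadPow T X.A 0 :=
  X.a

lemma mapPow_comp {n m k : ℕ} (f : monadPow T A n ⟶ monadPow T A m)
    (g : monadPow T A m ⟶ monadPow T A k) : mapPow (f ≫ g) = mapPow f ≫ mapPow g :=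
  T.map_comp f g

lemma mapPow_id (n : ℕ) : mapPow (𝟙 (monadPow T A n)) = 𝟙 _ :=
  T.map_id _

lemma unitPow_naturality {n m : ℕ} (f : monadPow T A n ⟶ monadPow T A m) :
    unitPow T A n ≫ mapPow f = f ≫ unitPow T A m :=
  (T.η.naturality f).symm

lemma mulPow_naturality {n m : ℕ} (f : monadPow T A n ⟶ monadPow T A m) :
    mulPow T A n ≫ mapPow f = mapPow (mapPow f) ≫ mulPow T A m :=
  (T.μ.naturality f).symm

lemma unitPow_mulPow (n : ℕ) : unitPow T A (n + 1) ≫ mulPow T A n = 𝟙 _ :=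
  T.left_unit _

lemma mapPow_unitPow_mulPow (n : ℕ) : mapPow (unitPow T A n) ≫ mulPow T A n = 𝟙 _ :=
  T.right_unit _

lemma mulPow_mulPow (n : ℕ) :
    mulPow T A (n + 1) ≫ mulPow T A n = mapPow (mulPow T A n) ≫ mulPow T A n :=
  (T.assoc _).symm

lemma unitPow_actPow (X : T.Algebra) : unitPow T X.A 0 ≫ actPow X = 𝟙 _ :=
  X.unit

lemma mulPow_actPow (X : T.Algebra) : mulPow T X.A 0 ≫ actPow X = mapPow (actPow X) ≫ actPow X :=
  X.assoc

end

/-- The map `T^n UX ⟶ T^m UX` induced by a map `φ : [m] → [n]` of `Δ₀`, regarded as a function on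
natural numbers. The `j`-th factor `T` of the source (`1 ≤ j ≤ n`, numbered from the outside) is
sent to the `i`-th factor of the target for which `φ (i - 1) < j ≤ φ i`. Each factor of the target
is obtained by (iterated) multiplication from the factors sent to it (by the unit if there are
none), and the factors with `φ m < j` act on `X` by the structure map. -/
def barMap (X : T.Algebra) : ∀ (n m : ℕ) (_φ : ℕ → ℕ), monadPow T X.A n ⟶ monadPow T X.A m
  | 0, 0, _ => 𝟙 _
  | n + 1, 0, φ => mapPow (barMap X n 0 φ) ≫ actPow X
  | 0, m + 1, φ => barMap X 0 m (fun i => φ (i + 1)) ≫ unitPow T X.A m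
  | n + 1, m + 1, φ =>
    if φ 1 = 0 then barMap X (n + 1) m (fun i => φ (i + 1)) ≫ unitPow T X.A m
    else mapPow (barMap X n (m + 1) (fun i => φ i - 1)) ≫ mulPow T X.A m
  termination_by n m => n + m

/-- The maps on which `barMap` is functorial: those coming from `[m] → [n]` in `Δ₀`. -/
structure IsMinMap (n : ℕ) (φ : ℕ → ℕ) : Prop where
  mono : Monotone φ
  zero : φ 0 = 0
  le : ∀ i, φ i ≤ n

lemma IsMinMap.shift {n : ℕ} {φ : ℕ → ℕ} (h : IsMinMap n φ) (h₁ : φ 1 = 0) :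
    IsMinMap n fun i => φ (i + 1) :=
  ⟨fun _ _ hij => h.mono (Nat.succ_le_succ hij), h₁, fun _ => h.le _⟩

lemma IsMinMap.pred {n : ℕ} {φ : ℕ → ℕ} (h : IsMinMap (n + 1) φ) :
    IsMinMap n fun i => φ i - 1 :=
  ⟨fun _ _ hij => Nat.sub_le_sub_right (h.mono hij) 1, by simp [h.zero],
    fun i => by have := h.le i; omega⟩

lemma barMap_of_eq_zero (X : T.Algebra) (n m : ℕ) (φ : ℕ → ℕ) (h : φ 1 = 0) :
    barMap X n (m + 1) φ = barMap X n m (fun i => φ (i + 1)) ≫ unitPow T X.A m := by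
  cases n with
  | zero => rw [barMap]
  | succ n => rw [barMap, if_pos h]

lemma barMap_of_ne_zero (X : T.Algebra) (n m : ℕ) (φ : ℕ → ℕ) (h : φ 1 ≠ 0) :
    barMap X (n + 1) (m + 1) φ =
      mapPow (barMap X n (m + 1) (fun i => φ i - 1)) ≫ mulPow T X.A m := by
  rw [barMap, if_neg h]

lemma barMap_zero (X : T.Algebra) (n : ℕ) (φ ψ : ℕ → ℕ) : barMap X n 0 φ = barMap X n 0 ψ := by
  induction n with
  | zero => rw [barMap, barMap]
  | succ n ih => rw [barMap, barMap, ih]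

lemma barMap_succ_zero (X : T.Algebra) (n : ℕ) (φ ψ : ℕ → ℕ) :
    barMap X (n + 1) 0 φ = mapPow (barMap X n 0 ψ) ≫ actPow X := by
  rw [barMap, barMap_zero X n φ ψ]

lemma barMap_id (X : T.Algebra) (n : ℕ) : barMap X n n (fun i => min i n) = 𝟙 _ := by
  induction n with
  | zero => rw [barMap]
  | succ n ih =>
    rw [barMap_of_ne_zero _ _ _ _ (by simp), barMap_of_eq_zero _ _ _ _ (by simp)]
    have : (fun i => min (i + 1) (n + 1) - 1) = fun i => min i n := by
      funext i
      omega
    rw [this, ih, Category.id_comp, mapPow_unitPow_mulPow]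

lemma barMap_comp (X : T.Algebra) (n m k : ℕ) (φ ψ : ℕ → ℕ) (hφ : IsMinMap n φ)
    (hψ : IsMinMap m ψ) :
    barMap X n m φ ≫ barMap X m k ψ = barMap X n k (fun i => φ (ψ i)) := by
  induction h : n + m + k using Nat.strong_induction_on generalizing n m k φ ψ with
  | _ N ih =>
  subst h
  cases k with
  | zero =>
    cases m with
    | zero =>
      rw [show barMap X 0 0 ψ = 𝟙 _ by rw [barMap], Category.comp_id]
      exact barMap_zero _ _ _ _
    | succ m =>
      by_cases h₁ : φ 1 = 0
      · have e := ih (n + m + 0) (by omega) n m 0 _ (fun _ => 0) (hφ.shift h₁)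
          ⟨fun _ _ _ => le_rfl, rfl, fun _ => Nat.zero_le _⟩ rfl
        rw [barMap_of_eq_zero _ _ _ _ h₁, barMap_succ_zero X m ψ (fun _ => 0), Category.assoc,
          reassoc_of% (unitPow_naturality (barMap X m 0 fun _ => 0)), unitPow_actPow,
          Category.comp_id, e]
        exact barMap_zero _ _ _ _
      · obtain ⟨n, rfl⟩ : ∃ n', n = n' + 1 :=
          ⟨n - 1, by have := hφ.le 1; omega⟩
        have e := ih (n + (m + 1) + 0) (by omega) n (m + 1) 0 _ ψ hφ.pred hψ rfl
        rw [barMap_succ_zero X n _ (fun i => φ (ψ i) - 1), ← e, barMap_of_ne_zero _ _ _ _ h₁,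
          barMap_succ_zero X m ψ ψ, Category.assoc,
          reassoc_of% (mulPow_naturality (barMap X m 0 ψ)), mulPow_actPow, mapPow_comp,
          mapPow_comp, Category.assoc, Category.assoc]
  | succ k =>
    by_cases h₂ : ψ 1 = 0
    · have e := ih (n + m + k) (by omega) n m k φ _ hφ (hψ.shift h₂) rfl
      rw [barMap_of_eq_zero _ _ _ _ h₂,
        barMap_of_eq_zero X n k (fun i => φ (ψ i)) (by rw [h₂, hφ.zero]), ← e, Category.assoc]
    · obtain ⟨m, rfl⟩ : ∃ m', m = m' + 1 :=
        ⟨m - 1, by have := hψ.le 1; omega⟩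
      by_cases h₁ : φ 1 = 0
      · have e := ih (n + m + (k + 1)) (by omega) n m (k + 1) _ _ (hφ.shift h₁) hψ.pred rfl
        have e₁ : (fun i => φ (ψ i - 1 + 1)) = fun i => φ (ψ i) := by
          funext i
          rcases Nat.eq_zero_or_pos (ψ i) with h₀ | h₀
          · rw [h₀, hφ.zero]
            exact h₁
          · rw [Nat.sub_add_cancel h₀]
        rw [e₁] at e
        rw [barMap_of_ne_zero X m k ψ h₂, barMap_of_eq_zero _ _ _ _ h₁, ← e, Category.assoc,
          reassoc_of% (unitPow_naturality (barMap X m (k + 1) fun i => ψ i - 1)),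
          unitPow_mulPow, Category.comp_id]
      · obtain ⟨n, rfl⟩ : ∃ n', n = n' + 1 :=
          ⟨n - 1, by have := hφ.le 1; omega⟩
        have e := ih (n + (m + 1) + (k + 1)) (by omega) n (m + 1) (k + 1) _ ψ hφ.pred hψ rfl
        have h₀ : φ (ψ 1) ≠ 0 := by
          have := hφ.mono (Nat.one_le_iff_ne_zero.2 h₂)
          omega
        rw [barMap_of_ne_zero _ _ _ _ h₁, barMap_of_ne_zero X n k (fun i => φ (ψ i)) h₀, ← e,
          barMap_of_ne_zero X m k ψ h₂, Category.assoc,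
          reassoc_of% (mulPow_naturality (barMap X m (k + 1) fun i => ψ i - 1)), mulPow_mulPow,
          mapPow_comp, mapPow_comp, Category.assoc, Category.assoc]

/-- The function on natural numbers extending a map of `Δ` (constant after the last vertex). -/
def natMap {a b : SimplexCategory} (f : a ⟶ b) (i : ℕ) : ℕ :=
  (f.toOrderHom ⟨min i a.len, Nat.lt_succ_of_le (min_le_right _ _)⟩ : Fin (b.len + 1))

lemma natMap_isMinMap {a b : SimplexCategory} (f : a ⟶ b) (hf : minPreserving f) :
    IsMinMap b.len (natMap f) where
  mono i j hij := f.toOrderHom.monotone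
    (Fin.mk_le_mk.2 (min_le_min_right _ hij))
  zero := by
    have : (⟨min 0 a.len, Nat.lt_succ_of_le (min_le_right _ _)⟩ : Fin (a.len + 1)) = 0 := by
      ext
      simp
    rw [natMap, this, show f.toOrderHom 0 = 0 from hf]
    rfl
  le i := Nat.le_of_lt_succ (Fin.isLt _)

lemma natMap_comp {a b c : SimplexCategory} (f : a ⟶ b) (g : b ⟶ c) :
    natMap (f ≫ g) = fun i => natMap g (natMap f i) := by
  funext i
  have : ∀ x : Fin (b.len + 1),
      (⟨min (x : ℕ) b.len, Nat.lt_succ_of_le (min_le_right _ _)⟩ : Fin (b.len + 1)) = x := by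
    intro x
    ext
    exact min_eq_left (Nat.le_of_lt_succ x.isLt)
  simp only [natMap, this]
  rfl

/-- The `Δ₀ᵒᵖ`-diagram `T^• UX` of a `T`-algebra `X`, with `(T^• UX)[n] = T^n UX` and the faces
(other than `d₀`) and degeneracies of the bar construction: `d_i = T^(i-1) μ T^(n-i-1)` for
`0 < i < n`, `d_n = T^(n-1) a` with `a : TX ⟶ X` the structure map, and `s_i = T^i η T^(n-i)`. -/
def barDiagram (X : T.Algebra) : DeltaZeroᵒᵖ ⥤ C where
  obj n := monadPow T X.A n.unop.obj.len
  map f := barMap X _ _ (natMap f.unop.hom)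
  map_id n := barMap_id X _
  map_comp f g := by
    rw [barMap_comp X _ _ _ _ _ (natMap_isMinMap _ f.unop.property)
      (natMap_isMinMap _ g.unop.property), ← natMap_comp]
    rfl

end

/-! ### Quillen monads and resolvable algebras -/

section

variable {C : Type v} [Category.{w} C] [SimplicialCategory C] [CategoryWithCofibrations C]
  [CategoryWithFibrations C] [CategoryWithWeakEquivalences C]

/-- The data making a monad `T` on `C` a Quillen monad: `C` is a simplicial model category, `T` is
a simplicial monad, and the simplicial category of `T`-algebras is equipped with a simplicial model
structure for which the forgetful functor `U` (which is simplicial, with left adjoint the free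
algebra functor) is right Quillen and a map `f` is a weak equivalence if and only if `U f` is. -/
structure QuillenMonadStructure (T : Monad C) where
  isSimplicialModelCategory : IsSimplicialModelCategory C
  simplicial : SimplicialMonadStructure T
  [cof : CategoryWithCofibrations T.Algebra]
  [fib : CategoryWithFibrations T.Algebra]
  [weq : CategoryWithWeakEquivalences T.Algebra]
  algebra_isSimplicialModelCategory :
    letI := simplicial.algebraSimplicialCategory
    IsSimplicialModelCategory T.Algebra
  forget_fibration : ∀ ⦃X Y : T.Algebra⦄ (f : X ⟶ Y), Fibration f → Fibration (T.forget.map f)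
  forget_trivialFibration : ∀ ⦃X Y : T.Algebra⦄ (f : X ⟶ Y), Fibration f → WeakEquivalence f →
    Fibration (T.forget.map f) ∧ WeakEquivalence (T.forget.map f)
  weakEquivalence_iff : ∀ ⦃X Y : T.Algebra⦄ (f : X ⟶ Y),
    WeakEquivalence f ↔ WeakEquivalence (T.forget.map f)

/-- Two objects are weakly equivalent if they are related by a zigzag of weak equivalences. -/
def WeaklyEquivalent {D : Type v} [Category.{w} D] [CategoryWithWeakEquivalences D] :
    D → D → Prop :=
  Relation.EqvGen fun X Y => ∃ f : X ⟶ Y, WeakEquivalence f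

/-- A `T`-algebra `X` is resolvable if it is weakly equivalent, as a `T`-algebra, to some
`T`-algebra `Y` for which `T^• UY` is Reedy cofibrant. -/
def QuillenMonadStructure.IsResolvable [HasColimitsOfSize.{0, 0} C] {T : Monad C}
    (Q : QuillenMonadStructure T) (X : T.Algebra) : Prop :=
  ∃ Y : T.Algebra,
    (letI := Q.weq
     WeaklyEquivalent X Y) ∧
    DeltaZero.IsReedyCofibrant (barDiagram Y)

end

/-!
The category `Δ₀` is an Eilenberg–Zilber Reedy category, and this alone makes every diagram
`Δ₀ᵒᵖ ⥤ sSet^S` Reedy cofibrant; a `T`-algebra is then resolved by itself.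

Factorizations in `Δ₀` are the image factorizations of `Δ`. A section of a surjection `σ` of `Δ₀` is
the same thing as a set-theoretic section that sends `0` to `0` (`DeltaZero.exists_section`), so
every `x` with `σ x ≠ 0` is a value of a section of `σ`; hence the sections of `σ` determine `σ`.

For a presheaf of sets on an Eilenberg–Zilber Reedy category, the Eilenberg–Zilber lemma
(`HomotopicalAlgebra.ReedyStructure.exists_nondegenerate`, `IsEilenbergZilber.eq_of_map_eq`) writes
each element uniquely as a degeneracy of a nondegenerate one. Two elements of the latching diagram with the same image in `X_n` therefore come
from the same nondegenerate element along the same surjection, so they agree in the latching object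
(`DeltaZero.cocone_ι_app_eq`). The functors `X ↦ (X s)_m` from `sSet^S` to sets preserve colimits
and jointly detect cofibrations, and they send the initial object to the empty set, which reduces
the relative latching map of `∅ ⟶ X` to the latching map of `X`
(`DeltaZero.injective_map_relativeLatchingMap`).
-/

/-! ### `Δ₀` as an Eilenberg–Zilber Reedy category -/

namespace DeltaZero

/-- Any set-theoretic section of a surjection of `Δ₀` that preserves `0` is monotone, so a section
can be chosen freely away from `0`. -/
lemma exists_section {X Y : DeltaZero} (σ : X ⟶ Y) (hσ : surjections σ)
    (x : Fin (X.obj.len + 1)) (hx : σ.hom.toOrderHom x = 0 → x = 0) :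
    ∃ τ ∈ sectionsOf σ, τ.hom.toOrderHom (σ.hom.toOrderHom x) = x := by
  have hσ' : Function.Surjective σ.hom.toOrderHom := hσ
  have hσ₀ : σ.hom.toOrderHom 0 = 0 := σ.property
  let g : Fin (Y.obj.len + 1) → Fin (X.obj.len + 1) := fun j =>
    if j = σ.hom.toOrderHom x then x else if j = 0 then 0 else Function.surjInv hσ' j
  have hg : ∀ j, σ.hom.toOrderHom (g j) = j := by
    intro j
    by_cases h₁ : j = σ.hom.toOrderHom x
    · simp [g, h₁]
    · by_cases h₂ : j = 0
      · rw [h₂] at h₁ ⊢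
        simp [g, h₁, hσ₀]
      · simp [g, h₁, h₂, Function.surjInv_eq hσ']
  have hg₀ : g 0 = 0 := by
    by_cases h₁ : 0 = σ.hom.toOrderHom x
    · simp [g, hx h₁.symm]
    · simp [g, h₁]
  have hmono : Monotone g := by
    intro i j hij
    by_contra! h
    have h' := σ.hom.toOrderHom.monotone h.le
    rw [hg, hg] at h'
    rw [le_antisymm hij h'] at h
    exact h.false
  refine ⟨⟨SimplexCategory.Hom.mk ⟨g, hmono⟩, hg₀⟩, ?_, ?_⟩
  · apply WideSubcategory.hom_ext _
    ext j : 3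
    exact hg j
  · exact if_pos rfl

/-- An injection of `Δ₀` between objects of the same degree is an identity. -/
lemma identities_of_len_eq {X Y : DeltaZero} (f : X ⟶ Y) (hf : injections f)
    (h : X.obj.len = Y.obj.len) : MorphismProperty.identities DeltaZero f := by
  obtain ⟨X⟩ := X
  obtain ⟨Y⟩ := Y
  obtain rfl : X = Y := SimplexCategory.ext h
  have : Mono f.hom := SimplexCategory.mono_iff_injective.2 hf
  have : f = 𝟙 _ := WideSubcategory.hom_ext _ (SimplexCategory.eq_id_of_mono f.hom)
  rw [this]
  exact ⟨_⟩

lemma injections_of_surjections {X Y : DeltaZero} (f : X ⟶ Y) (hf : surjections f)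
    (h : X.obj.len = Y.obj.len) : injections f :=
  ((Fintype.bijective_iff_surjective_and_card _).2 ⟨hf, by simp [h]⟩).injective

/-- The factorization of a map of `Δ₀` as a surjection followed by an injection, given by the
image in `Δ`. -/
noncomputable def imageFactorization {X Y : DeltaZero} (f : X ⟶ Y) :
    surjections.MapFactorizationData injections f :=
  have he := SimplexCategory.epi_iff_surjective.1
    (inferInstance : Epi (factorThruImage f.hom))
  have he₀ : (factorThruImage f.hom).toOrderHom 0 = 0 := by
    obtain ⟨x, hx⟩ := he 0
    exact le_antisymm (hx ▸ (factorThruImage f.hom).toOrderHom.monotone (Fin.zero_le x))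
      (Fin.zero_le _)
  have hfac : (image.ι f.hom).toOrderHom ((factorThruImage f.hom).toOrderHom 0) =
      f.hom.toOrderHom 0 :=
    congrArg (fun g : X.obj ⟶ Y.obj => g.toOrderHom 0) (image.fac f.hom)
  { Z := ⟨image f.hom⟩
    i := ⟨factorThruImage f.hom, he₀⟩
    p := ⟨image.ι f.hom, by
      change (image.ι f.hom).toOrderHom 0 = 0
      rw [he₀] at hfac
      exact hfac.trans f.property⟩
    fac := WideSubcategory.hom_ext _ (image.fac f.hom)
    hi := he
    hp := SimplexCategory.mono_iff_injective.1 inferInstance }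

lemma eq_imageFactorization {X Y : DeltaZero} (f : X ⟶ Y)
    (F : surjections.MapFactorizationData injections f) : F = imageFactorization f := by
  obtain ⟨⟨Z⟩, i, p, fac, hi, hp⟩ := F
  have : Epi i.hom := SimplexCategory.epi_iff_surjective.2 hi
  have : Mono p.hom := SimplexCategory.mono_iff_injective.2 hp
  have hfac : i.hom ≫ p.hom = f.hom := congrArg (fun g : X ⟶ Y => g.hom) fac
  obtain rfl : image f.hom = Z := SimplexCategory.image_eq hfac
  obtain rfl : i = (imageFactorization f).i :=
    WideSubcategory.hom_ext _ (SimplexCategory.factorThruImage_eq hfac).symm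
  obtain rfl : p = (imageFactorization f).p :=
    WideSubcategory.hom_ext _ (SimplexCategory.image_ι_eq hfac).symm
  rfl

/-- The Reedy structure on `Δ₀`, with `[n]` of degree `n`. -/
noncomputable def reedyStructure : ReedyStructure surjections injections ℕ where
  deg n := n.obj.len
  lt₁ {X Y} f hf hf' := by
    have : Epi f.hom := SimplexCategory.epi_iff_surjective.2 hf
    refine lt_of_le_of_ne (SimplexCategory.len_le_of_epi f.hom) fun h => hf' ?_
    exact identities_of_len_eq f (injections_of_surjections f hf h.symm) h.symm
  lt₂ {X Y} f hf hf' := by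
    have : Mono f.hom := SimplexCategory.mono_iff_injective.2 hf
    exact lt_of_le_of_ne (SimplexCategory.len_le_of_mono f.hom)
      fun h => hf' (identities_of_len_eq f hf h)
  nonempty_unique f := ⟨⟨⟨imageFactorization f⟩, eq_imageFactorization f⟩⟩

/-- If every section of `σ₁` is a section of `σ₂`, then `σ₁` and `σ₂` agree at every `x` with
`σ₁ x ≠ 0`. -/
lemma apply_eq_of_sectionsOf_subset {X Y : DeltaZero} (σ₁ σ₂ : X ⟶ Y) (h₁ : surjections σ₁)
    (h : sectionsOf σ₁ ⊆ sectionsOf σ₂) (x : Fin (X.obj.len + 1))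
    (hx : σ₁.hom.toOrderHom x ≠ 0) : σ₂.hom.toOrderHom x = σ₁.hom.toOrderHom x := by
  obtain ⟨τ, hτ, hτx⟩ := exists_section σ₁ h₁ x (fun h₀ => (hx h₀).elim)
  have e : τ ≫ σ₂ = 𝟙 Y := h hτ
  have e' : σ₂.hom.toOrderHom (τ.hom.toOrderHom (σ₁.hom.toOrderHom x)) =
      σ₁.hom.toOrderHom x :=
    congrArg (fun g : Y ⟶ Y => g.hom.toOrderHom (σ₁.hom.toOrderHom x)) e
  rwa [hτx] at e'

lemma isEilenbergZilber_reedyStructure : IsEilenbergZilber reedyStructure where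
  ez1 X Y σ hσ :=
    have ⟨τ, hτ, _⟩ := exists_section σ hσ 0 fun _ => rfl
    ⟨τ, hτ⟩
  ez2 X Y σ₁ σ₂ h₁ h₂ hne h := by
    apply hne
    apply WideSubcategory.hom_ext _
    ext x : 3
    by_cases hx₁ : σ₁.hom.toOrderHom x = 0
    · by_cases hx₂ : σ₂.hom.toOrderHom x = 0
      · exact hx₁.trans hx₂.symm
      · exact apply_eq_of_sectionsOf_subset σ₂ σ₁ h₂ h.superset x hx₂
    · exact (apply_eq_of_sectionsOf_subset σ₁ σ₂ h₁ h.subset x hx₁).symm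

end DeltaZero

/-! ### The Eilenberg–Zilber lemma -/

section

variable {R : Type u} [Category.{v} R] (Wm : MorphismProperty R)

/-- An element of a presheaf of sets is nondegenerate, with respect to a class `Wm` of
degree-lowering maps, if it is a restriction along a map of `Wm` only for the identity. -/
def IsNondegenerate (Z : Rᵒᵖ ⥤ Type w) {X : R} (z : Z.obj (op X)) : Prop :=
  ∀ ⦃Y : R⦄ (σ : X ⟶ Y) (y : Z.obj (op Y)), Wm σ → Z.map σ.op y = z →
    MorphismProperty.identities R σ

variable {Wm} {Wp : MorphismProperty R} [Wm.IsMultiplicative] [Wp.IsMultiplicative]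

lemma HomotopicalAlgebra.ReedyStructure.exists_nondegenerate (r : ReedyStructure Wm Wp ℕ)
    (Z : Rᵒᵖ ⥤ Type w) {X : R} (z : Z.obj (op X)) :
    ∃ (Y : R) (σ : X ⟶ Y) (y : Z.obj (op Y)),
      Wm σ ∧ IsNondegenerate Wm Z y ∧ Z.map σ.op y = z := by
  induction h : r.deg X using Nat.strong_induction_on generalizing X with
  | _ n ih =>
  subst h
  by_cases hz : IsNondegenerate Wm Z z
  · exact ⟨X, 𝟙 X, z, Wm.id_mem X, hz, by simp⟩
  · simp only [IsNondegenerate, not_forall] at hz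
    obtain ⟨Y, σ, y, hσ, rfl, hne⟩ := hz
    obtain ⟨Y', σ', y', hσ', hy', rfl⟩ := ih _ (r.lt₁ σ hσ hne) y rfl
    exact ⟨Y', σ ≫ σ', y', Wm.comp_mem _ _ hσ hσ', hy', by simp⟩

/-- A map which restricts some element to a nondegenerate element is degree-raising, since the
degree-lowering part of its factorization must be an identity. -/
lemma IsNondegenerate.prop_of_map_eq (r : ReedyStructure Wm Wp ℕ) {Z : Rᵒᵖ ⥤ Type w}
    {X Y : R} {x : Z.obj (op X)} (hx : IsNondegenerate Wm Z x) (f : X ⟶ Y) (y : Z.obj (op Y)) (h : Z.map f.op y = x) :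
    Wp f := by
  obtain ⟨W, a, b, ha, hb, rfl, -⟩ := r.exists_fac f
  have := hx a (Z.map b.op y) ha (by simpa using h)
  cases this
  simpa using hb

/-- The uniqueness part of the Eilenberg–Zilber lemma: the object, the degree-lowering map and the
nondegenerate element with a given degeneracy are unique. -/
lemma IsEilenbergZilber.eq_of_map_eq {r : ReedyStructure Wm Wp ℕ} (hr : IsEilenbergZilber r)
    (Z : Rᵒᵖ ⥤ Type w) {X Y Y' : R} (σ : X ⟶ Y) (σ' : X ⟶ Y') (hσ : Wm σ) (hσ' : Wm σ')
    (y : Z.obj (op Y)) (y' : Z.obj (op Y')) (hy : IsNondegenerate Wm Z y)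
    (hy' : IsNondegenerate Wm Z y') (h : Z.map σ.op y = Z.map σ'.op y') :
    (⟨Y, σ, y⟩ : Σ Y : R, (X ⟶ Y) × Z.obj (op Y)) = ⟨Y', σ', y'⟩ := by
  have key : ∀ {Y Y' : R} (σ : X ⟶ Y) (σ' : X ⟶ Y') (y : Z.obj (op Y)) (y' : Z.obj (op Y')),
      Z.map σ.op y = Z.map σ'.op y' → ∀ τ ∈ sectionsOf σ, Z.map (τ ≫ σ').op y' = y := by
    intro Y Y' σ σ' y y' h τ hτ
    have hτ' : τ ≫ σ = 𝟙 Y := hτ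
    rw [op_comp, Functor.map_comp_apply, ← h, ← Functor.map_comp_apply, ← op_comp, hτ',
      op_id, Functor.map_id_apply]
  have h₁ : ∀ τ ∈ sectionsOf σ, Wp (τ ≫ σ') := fun τ hτ =>
    hy.prop_of_map_eq r (τ ≫ σ') y' (key σ σ' y y' h τ hτ)
  have h₂ : ∀ τ ∈ sectionsOf σ', Wp (τ ≫ σ) := fun τ hτ =>
    hy'.prop_of_map_eq r (τ ≫ σ) y (key σ' σ y' y h.symm τ hτ)
  obtain ⟨τ, hτ⟩ := hr.ez1 σ hσ
  obtain ⟨τ', hτ'⟩ := hr.ez1 σ' hσ'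
  -- Both composites are degree-raising, so the degrees agree and the composites are identities.
  have hdeg : r.deg Y = r.deg Y' := le_antisymm (r.le₂ _ (h₁ τ hτ)) (r.le₂ _ (h₂ τ' hτ'))
  obtain rfl : Y = Y' := by
    have := r.identities_of_prop₂_of_eq (h₁ τ hτ) hdeg
    generalize τ ≫ σ' = f at this
    cases this
    rfl
  have hid : ∀ f : Y ⟶ Y, Wp f → f = 𝟙 Y := by
    intro f hf
    obtain ⟨_⟩ := r.identities_of_prop₂_of_eq hf rfl
    rfl
  obtain rfl : σ = σ' := by
    by_contra hne
    exact hr.ez2 σ σ' hσ hσ' hne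
      (Set.Subset.antisymm (fun τ hτ => hid _ (h₁ τ hτ)) (fun τ hτ => hid _ (h₂ τ hτ)))
  have := key σ σ y y' h τ hτ
  rw [show τ ≫ σ = 𝟙 Y from hτ, op_id, Functor.map_id_apply] at this
  rw [this]

end

/-! ### Latching maps -/

namespace DeltaZero

/-- Two elements of the latching diagram of a presheaf of sets with the same image in `Z_n` are
identified in every cocone, as both are degeneracies of one nondegenerate element. -/
lemma cocone_ι_app_eq (Z : DeltaZeroᵒᵖ ⥤ Type w) (n : DeltaZero)
    (c : Cocone (latchingDiagram Z n)) (σ τ : (LatchingIndex n)ᵒᵖ)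
    (x : (latchingDiagram Z n).obj σ) (y : (latchingDiagram Z n).obj τ)
    (h : Z.map σ.unop.obj.hom.op x = Z.map τ.unop.obj.hom.op y) :
    c.ι.app σ x = c.ι.app τ y := by
  -- A degeneracy of `u` at `σ` along `α` is identified with `u` itself, placed at `σ ≫ α`.
  -- The composite `σ ≫ α` is not an identity since degrees drop strictly along `σ`.
  have key : ∀ (σ : (LatchingIndex n)ᵒᵖ) (k : DeltaZero)
      (α : σ.unop.obj.right ⟶ k) (_ : surjections α) (u : Z.obj (op k)),
      ∃ hα : nonIdentitySurjections n (Under.mk (σ.unop.obj.hom ≫ α)),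
        c.ι.app σ (Z.map α.op u) = c.ι.app (op ⟨Under.mk (σ.unop.obj.hom ≫ α), hα⟩) u := by
    intro σ k α hα u
    have hσ := σ.unop.property
    have hne : ¬ MorphismProperty.identities DeltaZero (σ.unop.obj.hom ≫ α) := by
      intro hid
      have h₁ := reedyStructure.lt₁ _ hσ.1 hσ.2
      have h₂ := reedyStructure.le₁ α hα
      have h₃ : reedyStructure.deg n = reedyStructure.deg k := by
        generalize σ.unop.obj.hom ≫ α = f at hid
        cases hid
        rfl
      exact (h₂.trans_lt h₁).ne h₃.symm
    let ρ : LatchingIndex n :=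
      ⟨Under.mk (σ.unop.obj.hom ≫ α), surjections.comp_mem _ _ hσ.1 hα, hne⟩
    let t : σ.unop ⟶ ρ := ObjectProperty.homMk (Under.homMk α rfl)
    exact ⟨ρ.property, ConcreteCategory.congr_hom (c.w t.op) u⟩
  obtain ⟨k, α, u, hα, hu, rfl⟩ := reedyStructure.exists_nondegenerate Z
    (X := σ.unop.obj.right) x
  obtain ⟨l, β, v, hβ, hv, rfl⟩ := reedyStructure.exists_nondegenerate Z
    (X := τ.unop.obj.right) y
  obtain ⟨hσ', e₁⟩ := key σ k α hα u
  obtain ⟨hτ', e₂⟩ := key τ l β hβ v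
  have e := isEilenbergZilber_reedyStructure.eq_of_map_eq Z (σ.unop.obj.hom ≫ α)
    (τ.unop.obj.hom ≫ β) hσ'.1 hτ'.1 u v hu hv (by
      rw [op_comp, op_comp, Functor.map_comp_apply, Functor.map_comp_apply]
      exact h)
  refine e₁.trans (Eq.trans ?_ e₂.symm)
  obtain ⟨rfl, e'⟩ := Sigma.mk.inj_iff.1 e
  obtain ⟨e'', rfl⟩ := Prod.mk.inj (eq_of_heq e')
  clear e e' e₁ e₂ h
  generalize σ.unop.obj.hom ≫ α = f at hσ' e''
  subst e''
  rfl

variable {C : Type v} [Category.{w} C] [HasColimitsOfSize.{0, 0} C]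

lemma injective_map_latchingMap (F : C ⥤ Type w) [PreservesColimitsOfSize.{0, 0} F]
    (X : DeltaZeroᵒᵖ ⥤ C) (n : DeltaZero) : Function.Injective (F.map (latchingMap X n)) := by
  have hc := isColimitOfPreserves F (colimit.isColimit (latchingDiagram X n))
  have hι : ∀ (σ : (LatchingIndex n)ᵒᵖ) (x : F.obj ((latchingDiagram X n).obj σ)),
      F.map (latchingMap X n) (F.map (colimit.ι (latchingDiagram X n) σ) x) =
        F.map (X.map σ.unop.obj.hom.op) x := by
    intro σ x
    rw [← Functor.map_comp_apply]
    exact congrArg (fun g => F.map g x) (colimit.ι_desc (latchingCocone X n) σ)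
  intro a b hab
  obtain ⟨σ, x, rfl⟩ := Types.jointly_surjective_of_isColimit hc a
  obtain ⟨τ, y, rfl⟩ := Types.jointly_surjective_of_isColimit hc b
  exact cocone_ι_app_eq (X ⋙ F) n (F.mapCocone (colimit.cocone (latchingDiagram X n))) σ τ x y
    ((hι σ x).symm.trans (hab.trans (hι τ y)))

/-- For the map from the initial diagram, the relative latching map at `n` is injective on
`F`-elements, since all elements of its source come from the latching object. -/
lemma injective_map_relativeLatchingMap (F : C ⥤ Type w) [PreservesColimitsOfSize.{0, 0} F]
    (X : DeltaZeroᵒᵖ ⥤ C) (n : DeltaZero) :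
    Function.Injective (F.map (relativeLatchingMap (initial.to X) n)) := by
  have hempty : IsEmpty (F.obj ((⊥_ (DeltaZeroᵒᵖ ⥤ C)).obj (op n))) := by
    have h₁ : IsInitial (F.obj ((⊥_ (DeltaZeroᵒᵖ ⥤ C)).obj (op n))) :=
      (initialIsInitial.isInitialObj ((evaluation _ C).obj (op n))).isInitialObj F
    exact Function.isEmpty (β := PEmpty) (h₁.to PEmpty)
  have hc := isColimitOfPreserves F (colimit.isColimit
    (span (latchingMap (⊥_ (DeltaZeroᵒᵖ ⥤ C)) n) (latchingObjMap (initial.to X) n)))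
  have hsurj : Function.Surjective (F.map (pushout.inr
      (latchingMap (⊥_ (DeltaZeroᵒᵖ ⥤ C)) n) (latchingObjMap (initial.to X) n))) := by
    intro a
    obtain ⟨j, x, rfl⟩ := Types.jointly_surjective_of_isColimit hc a
    rcases j with _ | _ | _
    · exact (hempty.false (F.map (latchingMap (⊥_ (DeltaZeroᵒᵖ ⥤ C)) n) x)).elim
    · exact (hempty.false x).elim
    · exact ⟨x, rfl⟩
  intro a b hab
  obtain ⟨a, rfl⟩ := hsurj a
  obtain ⟨b, rfl⟩ := hsurj b
  rw [← Functor.map_comp_apply, ← Functor.map_comp_apply, relativeLatchingMap,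
    pushout.inr_desc] at hab
  rw [injective_map_latchingMap F X n hab]

end DeltaZero

/-! ### Diagrams in `sSet^S` -/

/-- Colimits in a category of families are computed componentwise. The index category may live in
any universe. -/
lemma preservesColimitsOfShape_piEval {I : Type*} {D : I → Type*} [∀ i, Category* (D i)]
    (J : Type*) [Category* J] [∀ i, HasColimitsOfShape J (D i)] (i : I) :
    PreservesColimitsOfShape J (Pi.eval D i) where
  preservesColimit {K} := by
    let c : Cocone K :=
      { pt := fun i => colimit (K ⋙ Pi.eval D i)
        ι :=
          { app := fun j i => colimit.ι (K ⋙ Pi.eval D i) j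
            naturality := fun _ _ f => by
              funext i
              exact (colimit.cocone (K ⋙ Pi.eval D i)).ι.naturality f } }
    let proj (s : Cocone K) (i : I) : Cocone (K ⋙ Pi.eval D i) := (Pi.eval D i).mapCocone s
    have hc : IsColimit c :=
      { desc := fun s i => colimit.desc _ (proj s i)
        fac := fun s j => by
          funext i
          exact colimit.ι_desc (proj s i) j
        uniq := fun s m w => by
          funext i
          exact (colimit.isColimit (K ⋙ Pi.eval D i)).uniq (proj s i) (m i)
            fun j => congrFun (w j) i }
    exact preservesColimit_of_preserves_colimit_cocone hc
      (colimit.isColimit (K ⋙ Pi.eval D i))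

open scoped SSet.modelCategoryQuillen in
lemma SSetPow.isReedyCofibrant {S : Type u} (X : DeltaZeroᵒᵖ ⥤ SSetPow S) :
    DeltaZero.IsReedyCofibrant X := by
  refine fun n => ⟨fun s => ?_⟩
  refine (HomotopicalAlgebra.cofibration_iff _).1
    ((SSet.modelCategoryQuillen.cofibration_iff _).2 ((NatTrans.mono_iff_mono_app _).2 fun m => ?_))
  have : PreservesColimitsOfSize.{0, 0} (Pi.eval (fun _ : S => SSet.{u}) s) :=
    ⟨fun {J} _ => preservesColimitsOfShape_piEval J s⟩
  exact (mono_iff_injective _).2 (DeltaZero.injective_map_relativeLatchingMap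
    (Pi.eval (fun _ : S => SSet.{u}) s ⋙ (evaluation _ _).obj m) X n)

theorem mainTheorem6 :
    (∃ r : ReedyStructure DeltaZero.surjections DeltaZero.injections ℕ,
      (∀ n : DeltaZero, r.deg n = n.obj.len) ∧ IsEilenbergZilber r) ∧
    (∀ (S : Type u) (X : DeltaZeroᵒᵖ ⥤ SSetPow S), DeltaZero.IsReedyCofibrant X) ∧
    (∀ (S : Type u) (T : Monad (SSetPow S)) (Q : QuillenMonadStructure T) (X : T.Algebra),
      Q.IsResolvable X) :=
  ⟨⟨DeltaZero.reedyStructure, fun _ => rfl, DeltaZero.isEilenbergZilber_reedyStructure⟩,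
    fun _ X => SSetPow.isReedyCofibrant X,
    fun _ _ _ X => ⟨X, Relation.EqvGen.refl X, SSetPow.isReedyCofibrant (barDiagram X)⟩⟩
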